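/- Let $\Bbbk$ be a field and $H$ a Hopf algebra over $\Bbbk$. Let $H^0=\{f\in H^* : f \text{ vanishes on a two-sided ideal of } H \text{ of finite codimension}\}$ be its finite dual, which is a Hopf algebra with convolution product $(f*g)(h)=f(h_1)g(h_2)$, unit $\varepsilon_H$, comultiplication determined by $f(ab)=f_1(a)f_2(b)$, and counit $f\mapsto f(1_H)$. Say that $H^0$ separates points if $h\in H$ and $f(h)=0$ for all $f\in H^0$ imply $h=0$. Definitions. (a) A coalgebra $D$ is a left $H$-comodule coalgebra via a linear map $\lambda\colon D\to H\otimes D$, $\lambda(d)=d^{-1}\otimes d^{0}$, if $\varepsilon(d^{-1})d^0=d$, $\ d^{-1}\otimes \Delta(d^0)=d_1{}^{-1}d_2{}^{-1}\otimes d_1{}^0\otimes d_2{}^0$ and $(I\otimes\lambda)\lambda=(\Delta_H\otimes I)\lambda$. A coalgebra $C$ is a left partial $H$-comodule coalgebra via a linear map $\lambda'\colon C\to H\otimes C$, $\lambda'(c)=c^{-1}\otimes c^{0}$, if the first two identities hold for $\lambda'$ and $(I\otimes\lambda')\lambda'(c)=\nabla(c_1)\,(c_2{}^{-1})_1\otimes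 (c_2{}^{-1})_2\otimes c_2{}^0$ for all $c$, where $\nabla(c)=c^{-1}\varepsilon(c^0)$. (b) A globalization of a left partial $H$-comodule coalgebra $(C,\lambda')$ is a triple $(D,\theta,\pi)$ in which $D$ is a left $H$-comodule coalgebra via some $\lambda$, $\theta\colon C\to D$ is an injective coalgebra map, $\pi$ is a linear projection from $D$ onto $\theta(C)$ with $\Delta\pi=(\pi\otimes\pi)\Delta$, and, for all $d\in D$ and $c\in C$: $\pi(d)^{-1}\otimes\pi(\pi(d)^0)=d_2{}^{-1}\otimes\varepsilon(\pi(d_1))\pi(d_2{}^0)$; $\ \theta(c)^{-1}\otimes\pi(\theta(c)^0)=c^{-1}\otimes\theta(c^0)$; and $D$ is the only subcoalgebra $M\subseteq D$ with $\lambda(M)\subseteq H\otimes M$ and $\theta(C)\subseteq M$. (c) Let $K$ be a Hopf algebra. A coalgebra $D$ is a right $K$-module coalgebra via a linear map $\cdot\colon D\otimes K\to D$ if $d\cdot 1=d$, $\Delta(d\cdot h)=d_1\cdot h_1\otimes d_2\cdot h_2$ and $(d\cdot h)\cdot g=d\cdot hg$. A coalgebra $C$ is a right partial $K$-module coalgebra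 if the first two identities hold and $(c\cdot h)\cdot g=\varepsilon(c_1\cdot h_1)\,(c_2\cdot h_2g)$. A globalization of a right partial $K$-module coalgebra $C$ is a triple $(D,\theta,\pi)$ in which $D$ is a right $K$-module coalgebra, $\theta$ and $\pi$ are as in (b) (an injective coalgebra map and a comultiplicative linear projection onto $\theta(C)$), and, for all $d\in D$, $c\in C$, $h\in K$: $\pi(\pi(d)\cdot h)=\pi(\varepsilon(\pi(d_1))d_2\cdot h)$; $\ \theta(c\cdot h)=\pi(\theta(c)\cdot h)$; and $D$ is spanned by the elements $\theta(c)\cdot h$. Theorem. Let $(C,\lambda')$ be a left partial $H$-comodule coalgebra and let $(D,\theta,\pi)$, with coaction $\lambda$ on $D$, be a globalization of it. If $H^0$ separates points, then $C$ is a right partial $H^0$-module coalgebra via $c\cdot f=f(c^{-1})c^{0}$, and $(D,\theta,\pi)$, with $D$ viewed as a right $H^0$-module coalgebra via $d\cdot f=f(d^{-1})d^{0}$, is a globalization of it. -/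

import Mathlib

open TensorProduct Coalgebra Bialgebra HopfAlgebra WithConv

namespace PartialHopf

noncomputable section

/-! ### The finite dual of a Hopf algebra -/

section FiniteDual

universe u v

variable {k : Type u} {H : Type v} [Field k] [Ring H]

/-- `f` belongs to the finite dual: it vanishes on a two-sided ideal of finite codimension. -/
def VanishesOnCofinite [Algebra k H] (f : H →ₗ[k] k) : Prop :=
  ∃ I : Ideal H, I.IsTwoSided ∧ FiniteDimensional k (H ⧸ I) ∧ ∀ a ∈ I, f a = 0

theorem VanishesOnCofinite.of_algHom [Algebra k H] {B : Type*} [Ring B] [Algebra k B]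
    [FiniteDimensional k B] (φ : H →ₐ[k] B) {f : H →ₗ[k] k}
    (hf : ∀ a, φ a = 0 → f a = 0) : VanishesOnCofinite f := by
  refine ⟨RingHom.ker φ, inferInstance, ?_, fun a ha => hf a ha⟩
  exact FiniteDimensional.of_injective
    ((Ideal.Quotient.liftₐ (RingHom.ker φ) φ (fun a ha => ha)).toLinearMap)
    (RingHom.kerLift_injective (φ : H →+* B))

theorem VanishesOnCofinite.add [Algebra k H] {f g : H →ₗ[k] k}
    (hf : VanishesOnCofinite f) (hg : VanishesOnCofinite g) : VanishesOnCofinite (f + g) := by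
  obtain ⟨I, _, _, hI⟩ := hf
  obtain ⟨J, _, _, hJ⟩ := hg
  refine .of_algHom ((Ideal.Quotient.mkₐ k I).prod (Ideal.Quotient.mkₐ k J)) fun a ha => ?_
  simp only [AlgHom.prod_apply, Ideal.Quotient.mkₐ_eq_mk, Prod.mk_eq_zero,
    Ideal.Quotient.eq_zero_iff_mem] at ha
  simp [hI a ha.1, hJ a ha.2]

/-- The convolution product of two elements of the finite dual is in the finite dual. -/
theorem VanishesOnCofinite.conv [Bialgebra k H] {f g : H →ₗ[k] k}
    (hf : VanishesOnCofinite f) (hg : VanishesOnCofinite g) :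
    VanishesOnCofinite (toConv f * toConv g).ofConv := by
  obtain ⟨I, _, _, hI⟩ := hf
  obtain ⟨J, _, _, hJ⟩ := hg
  let F : (H ⧸ I) →ₗ[k] k := (I.restrictScalars k).liftQ f hI
  let G : (H ⧸ J) →ₗ[k] k := (J.restrictScalars k).liftQ g hJ
  refine .of_algHom ((Algebra.TensorProduct.map (Ideal.Quotient.mkₐ k I)
    (Ideal.Quotient.mkₐ k J)).comp (comulAlgHom k H)) fun a ha => ?_
  have key : ∀ t : H ⊗[k] H, LinearMap.mul' k k (TensorProduct.map f g t) =
      LinearMap.mul' k k (TensorProduct.map F G (Algebra.TensorProduct.map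
        (Ideal.Quotient.mkₐ k I) (Ideal.Quotient.mkₐ k J) t)) := by
    intro t
    induction t with
    | zero => simp
    | tmul x y => rfl
    | add x y hx hy => simp only [map_add, hx, hy]
  rw [LinearMap.convMul_apply]
  refine (key _).trans ?_
  have : Algebra.TensorProduct.map (Ideal.Quotient.mkₐ k I) (Ideal.Quotient.mkₐ k J)
      (comul (R := k) a) = 0 := ha
  rw [this]; simp

variable (k H) in
/-- The finite dual `H⁰` of a bialgebra, as a subalgebra of the convolution algebra `H^*`:
the product is `(f * g)(h) = f(h₁) g(h₂)` and the unit is the counit of `H`. -/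
def finiteDual [Bialgebra k H] : Subalgebra k (WithConv (H →ₗ[k] k)) where
  carrier := {f | VanishesOnCofinite f.ofConv}
  mul_mem' hf hg := hf.conv hg
  add_mem' hf hg := hf.add hg
  algebraMap_mem' r := .of_algHom (counitAlgHom k H) fun a ha => by
    have ha' : counit (R := k) a = 0 := ha
    rw [LinearMap.convAlgebraMap_apply, ha']; simp

/-! The next facts concern a space `E` with functionals `p a`, `a : H`, that separate its elements;
they are used for `E = H⁰` and evaluations, to which `H⁰ ⊗ H⁰` and `H⁰ ⊗ H⁰ ⊗ H⁰` reduce. -/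

/-- The functional `v ⊗ w ↦ p(v) q(w)`. -/
def pairEv {V W : Type*} [AddCommGroup V] [Module k V] [AddCommGroup W] [Module k W]
    (p : V →ₗ[k] k) (q : W →ₗ[k] k) : V ⊗[k] W →ₗ[k] k :=
  LinearMap.mul' k k ∘ₗ TensorProduct.map p q

@[simp] theorem pairEv_tmul {V W : Type*} [AddCommGroup V] [Module k V] [AddCommGroup W]
    [Module k W] (p : V →ₗ[k] k) (q : W →ₗ[k] k) (v : V) (w : W) :
    pairEv p q (v ⊗ₜ w) = p v * q w := rfl

/-- Tensors over a field are separated by pairs of functionals out of separating families. -/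
theorem tensor_eq_of_separating {V W : Type*} [AddCommGroup V] [Module k V] [AddCommGroup W]
    [Module k W] {X Y : Type*} (p : X → V →ₗ[k] k) (q : Y → W →ₗ[k] k)
    (hp : ∀ v, (∀ x, p x v = 0) → v = 0) (hq : ∀ w, (∀ y, q y w = 0) → w = 0)
    {s t : V ⊗[k] W} (h : ∀ x y, pairEv (p x) (q y) s = pairEv (p x) (q y) t) : s = t := by
  classical
  rw [← sub_eq_zero]
  have h' : ∀ x y, pairEv (p x) (q y) (s - t) = 0 := by
    intro x y; rw [map_sub, h, sub_self]
  generalize s - t = r at h'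
  let b := Module.Basis.ofVectorSpace k V
  let e := TensorProduct.equivFinsuppOfBasisLeft (N := W) b
  have h1 : ∀ y, TensorProduct.rid k V (TensorProduct.map LinearMap.id (q y) r) = 0 := by
    intro y
    refine hp _ fun x => ?_
    rw [← h' x y]
    clear h'
    induction r with
    | zero => simp
    | tmul v w => simp [mul_comm]
    | add x y hx hy => simp only [map_add, hx, hy]
  have h2 : ∀ y i, q y (e r i) = 0 := by
    intro y i
    have : q y (e r i) = b.repr (TensorProduct.rid k V
        (TensorProduct.map LinearMap.id (q y) r)) i := by
      clear h' h1
      induction r with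
      | zero => simp
      | tmul v w =>
        simp [e, mul_comm]
      | add x y hx hy => simp only [map_add, hx, hy, Finsupp.add_apply]
    rw [this, h1]; simp
  have h3 : e r = 0 := by
    ext i
    exact hq _ fun y => h2 y i
  exact e.map_eq_zero_iff.mp h3

section Separated

set_option linter.unusedSectionVars false

variable {E : Type*} [AddCommGroup E] [Module k E] {p : H → E →ₗ[k] k} {Δ : E →ₗ[k] E ⊗[k] E}

theorem ext_pairEv (hp : ∀ v, (∀ a, p a v = 0) → v = 0) {s t : E ⊗[k] E}
    (h : ∀ a b, pairEv (p a) (p b) s = pairEv (p a) (p b) t) : s = t :=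
  tensor_eq_of_separating p p hp hp h

theorem coassoc_of_pairEv (hp : ∀ v, (∀ a, p a v = 0) → v = 0)
    (hΔ : ∀ a b f, pairEv (p a) (p b) (Δ f) = p (a * b) f) :
    TensorProduct.assoc k E E E ∘ₗ Δ.rTensor E ∘ₗ Δ = Δ.lTensor E ∘ₗ Δ := by
  ext f : 1
  refine tensor_eq_of_separating (X := H) (Y := H × H) p (fun y => pairEv (p y.1) (p y.2))
    hp (fun w hw => ext_pairEv hp fun a b => by rw [hw (a, b), map_zero]) fun a bc => ?_
  obtain ⟨b, c⟩ := bc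
  have h0 : ∀ (s : E ⊗[k] E) (y : E), pairEv (p a) (pairEv (p b) (p c))
      (TensorProduct.assoc k E E E (s ⊗ₜ y)) = pairEv (p a) (p b) s * p c y := by
    intro s y
    induction s with
    | zero => simp
    | tmul u v => simp [mul_assoc]
    | add u v hu hv => simp only [map_add, TensorProduct.add_tmul, hu, hv, add_mul]
  have h1 : ∀ t : E ⊗[k] E, pairEv (p a) (pairEv (p b) (p c)) (TensorProduct.assoc k E E E
      (Δ.rTensor E t)) = pairEv (p (a * b)) (p c) t := by
    intro t
    induction t with
    | zero => simp
    | tmul x y => rw [LinearMap.rTensor_tmul, pairEv_tmul, ← hΔ, h0]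
    | add x y hx hy => simp only [map_add, hx, hy]
  have h2 : ∀ t : E ⊗[k] E, pairEv (p a) (pairEv (p b) (p c)) (Δ.lTensor E t) =
      pairEv (p a) (p (b * c)) t := by
    intro t
    induction t with
    | zero => simp
    | tmul x y => simp [hΔ]
    | add x y hx hy => simp only [map_add, hx, hy]
  exact (h1 _).trans (Eq.trans (by rw [hΔ, hΔ, mul_assoc]) (h2 _).symm)

theorem rTensor_counit_of_pairEv (hp : ∀ v, (∀ a, p a v = 0) → v = 0)
    (hΔ : ∀ a b f, pairEv (p a) (p b) (Δ f) = p (a * b) f) :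
    (p 1).rTensor E ∘ₗ Δ = TensorProduct.mk k k E 1 := by
  ext f : 1
  apply (TensorProduct.lid k E).injective
  rw [← sub_eq_zero]
  refine hp _ fun a => ?_
  have : ∀ t : E ⊗[k] E,
      p a (TensorProduct.lid k _ ((p 1).rTensor _ t)) = pairEv (p 1) (p a) t := by
    intro t
    induction t with
    | zero => simp
    | tmul x y => simp
    | add x y hx hy => simp only [map_add, hx, hy]
  rw [map_sub, LinearMap.comp_apply, this, hΔ]; simp

theorem lTensor_counit_of_pairEv (hp : ∀ v, (∀ a, p a v = 0) → v = 0)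
    (hΔ : ∀ a b f, pairEv (p a) (p b) (Δ f) = p (a * b) f) :
    (p 1).lTensor E ∘ₗ Δ = (TensorProduct.mk k E k).flip 1 := by
  ext f : 1
  apply (TensorProduct.rid k E).injective
  rw [← sub_eq_zero]
  refine hp _ fun a => ?_
  have : ∀ t : E ⊗[k] E,
      p a (TensorProduct.rid k _ ((p 1).lTensor _ t)) = pairEv (p a) (p 1) t := by
    intro t
    induction t with
    | zero => simp
    | tmul x y => simp [mul_comm]
    | add x y hx hy => simp only [map_add, hx, hy]
  rw [map_sub, LinearMap.comp_apply, this, hΔ]; simp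

theorem pairEv_mul_repr {E : Type*} [Ring E] [Algebra k E] [Bialgebra k H] {p : H → E →ₗ[k] k}
    (hmul : ∀ {a : H} (r : Coalgebra.Repr k a (H × H)) (f g : E),
      p a (f * g) = ∑ i ∈ r.index, p (r.left i) f * p (r.right i) g)
    {a b : H} (r : Coalgebra.Repr k a (H × H))
    (r' : Coalgebra.Repr k b (H × H)) (s t : E ⊗[k] E) :
    pairEv (p a) (p b) (s * t) = ∑ i ∈ r.index, ∑ j ∈ r'.index,
      pairEv (p (r.left i)) (p (r'.left j)) s * pairEv (p (r.right i)) (p (r'.right j)) t := by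
  induction s with
  | zero => simp
  | add x y hx hy => simp only [add_mul, map_add, hx, hy, Finset.sum_add_distrib]
  | tmul f g =>
    induction t with
    | zero => simp
    | add x y hx hy => simp only [mul_add, map_add, hx, hy, Finset.sum_add_distrib]
    | tmul f' g' =>
      rw [Algebra.TensorProduct.tmul_mul_tmul, pairEv_tmul, hmul r, hmul r',
        Finset.sum_mul_sum]
      refine Finset.sum_congr rfl fun i _ => Finset.sum_congr rfl fun j _ => ?_
      simp only [pairEv_tmul]; ring

end Separated


variable (k H) in
/-- The finite dual `H⁰` as a type; its product and unit are those of the convolution algebra. -/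
def FiniteDual [Bialgebra k H] : Type (max u v) := finiteDual k H

namespace FiniteDual

section Bialg

variable [Bialgebra k H]

instance : Ring (FiniteDual k H) := inferInstanceAs (Ring (finiteDual k H))

instance : Algebra k (FiniteDual k H) := inferInstanceAs (Algebra k (finiteDual k H))

/-- An element of `H⁰` as a linear functional on `H`. -/
def toDual (f : FiniteDual k H) : H →ₗ[k] k := f.1.ofConv

/-- A functional that vanishes on an ideal of finite codimension, as an element of `H⁰`. -/
def mk (f : H →ₗ[k] k) (hf : VanishesOnCofinite f) : FiniteDual k H := ⟨toConv f, hf⟩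

/-- Evaluation of elements of `H⁰` at `h`. -/
def ev (h : H) : FiniteDual k H →ₗ[k] k where
  toFun f := f.toDual h
  map_add' _ _ := rfl
  map_smul' _ _ := rfl

theorem ev_apply (h : H) (f : FiniteDual k H) : ev h f = f.toDual h := rfl

theorem eq_zero_of_ev (f : FiniteDual k H) (hf : ∀ h, ev h f = 0) : f = 0 :=
  Subtype.ext (WithConv.ext (LinearMap.ext hf))

theorem ext_ev {f g : FiniteDual k H} (h : ∀ a, ev a f = ev a g) : f = g :=
  Subtype.ext (WithConv.ext (LinearMap.ext h))

theorem exists_comul (f : FiniteDual k H) :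
    ∃ t : FiniteDual k H ⊗[k] FiniteDual k H, ∀ a b, pairEv (ev a) (ev b) t = ev (a * b) f := by
  obtain ⟨⟨f⟩, I, _, _, hI⟩ := f
  let F : (H ⧸ I) →ₗ[k] k := (I.restrictScalars k).liftQ f hI
  let π := Ideal.Quotient.mkₐ k I
  let t₀ := (TensorProduct.dualDistribEquiv k (H ⧸ I) (H ⧸ I)).symm
    (F ∘ₗ LinearMap.mul' k (H ⧸ I))
  let P : Module.Dual k (H ⧸ I) →ₗ[k] FiniteDual k H :=
    { toFun := fun g => mk (g ∘ₗ π.toLinearMap) (.of_algHom π fun a ha => by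
          have : g (π a) = 0 := by rw [ha, map_zero]
          exact this)
      map_add' := fun _ _ => rfl
      map_smul' := fun _ _ => rfl }
  refine ⟨TensorProduct.map P P t₀, fun a b => ?_⟩
  have h1 : ∀ t, pairEv (ev a) (ev b) (TensorProduct.map P P t) =
      TensorProduct.dualDistrib k (H ⧸ I) (H ⧸ I) t (π a ⊗ₜ π b) := by
    intro t
    induction t with
    | zero => simp
    | tmul x y => rfl
    | add x y hx hy => simp only [map_add, hx, hy, LinearMap.add_apply]
  rw [h1]
  have h2 : TensorProduct.dualDistrib k (H ⧸ I) (H ⧸ I) t₀ = F ∘ₗ LinearMap.mul' k (H ⧸ I) :=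
    (TensorProduct.dualDistribEquiv k (H ⧸ I) (H ⧸ I)).apply_symm_apply _
  rw [h2]
  simp only [LinearMap.comp_apply, LinearMap.mul'_apply, ← map_mul]
  rfl

/-- The comultiplication of `H⁰`: the unique `Δ(f) = f₁ ⊗ f₂` with `f(ab) = f₁(a) f₂(b)`. -/
def comulMap : FiniteDual k H →ₗ[k] FiniteDual k H ⊗[k] FiniteDual k H where
  toFun f := (exists_comul f).choose
  map_add' f g := ext_pairEv eq_zero_of_ev fun a b => by
    rw [map_add, (exists_comul f).choose_spec, (exists_comul g).choose_spec,
      (exists_comul (f + g)).choose_spec, map_add]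
  map_smul' r f := ext_pairEv eq_zero_of_ev fun a b => by
    rw [map_smul, (exists_comul f).choose_spec, (exists_comul (r • f)).choose_spec, map_smul,
      RingHom.id_apply]

theorem pairEv_comulMap (a b : H) (f : FiniteDual k H) :
    pairEv (ev a) (ev b) (comulMap f) = ev (a * b) f :=
  (exists_comul f).choose_spec a b

/-- The coalgebra structure of `H⁰`; the counit is `f ↦ f(1)`. -/
instance : Coalgebra k (FiniteDual k H) where
  comul := comulMap
  counit := ev 1
  coassoc := coassoc_of_pairEv eq_zero_of_ev pairEv_comulMap
  rTensor_counit_comp_comul := rTensor_counit_of_pairEv eq_zero_of_ev pairEv_comulMap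
  lTensor_counit_comp_comul := lTensor_counit_of_pairEv eq_zero_of_ev pairEv_comulMap

theorem pairEv_comul (a b : H) (f : FiniteDual k H) :
    pairEv (ev a) (ev b) (comul (R := k) f) = ev (a * b) f :=
  pairEv_comulMap a b f

theorem counit_apply (f : FiniteDual k H) : counit (R := k) f = ev 1 f := rfl

theorem ev_one (a : H) : ev a (1 : FiniteDual k H) = counit (R := k) a := rfl

theorem ev_mul (a : H) (f g : FiniteDual k H) :
    ev a (f * g) = LinearMap.mul' k k (TensorProduct.map f.toDual g.toDual (comul a)) := rfl

theorem ev_mul_repr {ι : Type*} {a : H} (r : Coalgebra.Repr k a ι) (f g : FiniteDual k H) :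
    ev a (f * g) = ∑ i ∈ r.index, ev (r.left i) f * ev (r.right i) g :=
  r.convMul_apply f.1 g.1

instance : Bialgebra k (FiniteDual k H) := Bialgebra.mk' k (FiniteDual k H)
  (by rw [counit_apply, ev_one, Bialgebra.counit_one])
  (by
    intro f g
    rw [counit_apply, ev_mul, Bialgebra.comul_one, Algebra.TensorProduct.one_def]
    rfl)
  (ext_pairEv eq_zero_of_ev fun a b => by
    rw [pairEv_comul, Algebra.TensorProduct.one_def, pairEv_tmul, ev_one, ev_one, ev_one,
      Bialgebra.counit_mul])
  (by
    intro f g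
    refine ext_pairEv eq_zero_of_ev fun a b => ?_
    rw [pairEv_mul_repr (fun r => ev_mul_repr r) (ℛ k a) (ℛ k b), pairEv_comul,
      ev_mul_repr ((ℛ k a).mul (ℛ k b))]
    simp only [pairEv_comul, Coalgebra.Repr.mul_left, Coalgebra.Repr.mul_right,
      Coalgebra.Repr.mul_index, Finset.sum_product])

end Bialg

section Hopf

variable [HopfAlgebra k H]

theorem vanishesOnCofinite_antipode {f : H →ₗ[k] k} (hf : VanishesOnCofinite f) :
    VanishesOnCofinite (f ∘ₗ antipode k) := by
  obtain ⟨I, hI2, hIf, hI⟩ := hf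
  let J : Ideal H :=
    { carrier := {a | antipode k a ∈ I}
      add_mem' := fun {a b} ha hb => by
        change antipode k (a + b) ∈ I
        rw [map_add]; exact I.add_mem ha hb
      zero_mem' := by
        change antipode k (0 : H) ∈ I
        rw [map_zero]; exact I.zero_mem
      smul_mem' := fun c a ha => by
        change antipode k (c * a) ∈ I
        rw [antipode_mul_antidistrib]; exact I.mul_mem_right _ ha }
  have hJ : J.IsTwoSided := ⟨fun {a} b ha => by
    change antipode k (a * b) ∈ I
    rw [antipode_mul_antidistrib]; exact I.mul_mem_left _ ha⟩
  refine ⟨J, hJ, ?_, fun a ha => hI _ ha⟩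
  let q : (H ⧸ J) →ₗ[k] (H ⧸ I) := (J.restrictScalars k).mapQ (I.restrictScalars k)
    (antipode k) (fun a ha => ha)
  refine FiniteDimensional.of_injective q ?_
  rw [← LinearMap.ker_eq_bot, LinearMap.ker_eq_bot']
  intro x hx
  obtain ⟨a, rfl⟩ := Ideal.Quotient.mk_surjective x
  have ha : antipode k a ∈ I := Ideal.Quotient.eq_zero_iff_mem.mp hx
  exact Ideal.Quotient.eq_zero_iff_mem.mpr ha

/-- The antipode `f ↦ f ∘ S` of `H⁰`. -/
def antipodeMap : FiniteDual k H →ₗ[k] FiniteDual k H where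
  toFun f := mk (f.toDual ∘ₗ antipode k) (vanishesOnCofinite_antipode f.2)
  map_add' _ _ := rfl
  map_smul' _ _ := rfl

theorem ev_antipodeMap (a : H) (f : FiniteDual k H) :
    ev a (antipodeMap f) = ev (antipode k a) f := rfl

theorem ev_algebraMap (a : H) (r : k) :
    ev a (algebraMap k (FiniteDual k H) r) = r * counit (R := k) a := rfl

theorem ev_mul'_map {ι : Type*} {a : H} (r : Coalgebra.Repr k a ι)
    (φ ψ : FiniteDual k H →ₗ[k] FiniteDual k H) (φ' ψ' : H → H)
    (hφ : ∀ a f, ev a (φ f) = ev (φ' a) f) (hψ : ∀ a f, ev a (ψ f) = ev (ψ' a) f)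
    (t : FiniteDual k H ⊗[k] FiniteDual k H) :
    ev a (LinearMap.mul' k (FiniteDual k H) (TensorProduct.map φ ψ t)) =
      ∑ i ∈ r.index, pairEv (ev (φ' (r.left i))) (ev (ψ' (r.right i))) t := by
  induction t with
  | zero => simp
  | tmul x y =>
    rw [TensorProduct.map_tmul, LinearMap.mul'_apply, ev_mul_repr r]
    simp only [hφ, hψ, pairEv_tmul]
  | add x y hx hy => simp only [map_add, hx, hy, Finset.sum_add_distrib]

/-- The Hopf algebra structure of the finite dual `H⁰`. -/
instance : HopfAlgebra k (FiniteDual k H) where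
  antipode := antipodeMap
  mul_antipode_rTensor_comul := by
    refine LinearMap.ext fun f => ext_ev fun a => ?_
    refine (ev_mul'_map (ℛ k a) antipodeMap LinearMap.id (antipode k) id ev_antipodeMap
      (fun _ _ => rfl) _).trans ?_
    simp only [pairEv_comul, id]
    have h : ∀ x : H, ev x f = f.toDual x := fun _ => rfl
    simp only [h]
    rw [← map_sum, sum_antipode_mul_eq_smul, map_smul]
    exact mul_comm _ _
  mul_antipode_lTensor_comul := by
    refine LinearMap.ext fun f => ext_ev fun a => ?_
    refine (ev_mul'_map (ℛ k a) LinearMap.id antipodeMap id (antipode k)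
      (fun _ _ => rfl) ev_antipodeMap _).trans ?_
    simp only [pairEv_comul, id]
    have h : ∀ x : H, ev x f = f.toDual x := fun _ => rfl
    simp only [h]
    rw [← map_sum, sum_mul_antipode_eq_smul, map_smul]
    exact mul_comm _ _

end Hopf

variable (k H) in
/-- `H⁰` separates points of `H`: only `h = 0` is annihilated by every `f ∈ H⁰`. -/
def SeparatesPoints [Bialgebra k H] : Prop :=
  ∀ h : H, (∀ f : FiniteDual k H, f.toDual h = 0) → h = 0

end FiniteDual

end FiniteDual

/-! ### (Partial) module coalgebras and their globalizations -/

section Module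

variable {k K C D : Type*} [Field k] [Ring K] [HopfAlgebra k K]
  [AddCommGroup C] [Module k C] [Coalgebra k C] [AddCommGroup D] [Module k D] [Coalgebra k D]

/-- `D` is a right `K`-module coalgebra via `act (d ⊗ h) = d · h`. -/
structure IsModuleCoalgebra (act : D ⊗[k] K →ₗ[k] D) : Prop where
  /-- `d · 1 = d` -/
  act_one : ∀ d : D, act (d ⊗ₜ 1) = d
  /-- `Δ(d · h) = d₁ · h₁ ⊗ d₂ · h₂` -/
  comul_act : ∀ (d : D) (h : K), comul (R := k) (act (d ⊗ₜ h)) =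
    TensorProduct.map act act
      (TensorProduct.tensorTensorTensorComm k D D K K (comul d ⊗ₜ comul h))
  /-- `(d · h) · g = d · hg` -/
  act_act : ∀ (d : D) (h g : K), act (act (d ⊗ₜ h) ⊗ₜ g) = act (d ⊗ₜ (h * g))

/-- `C` is a right partial `K`-module coalgebra via `act (c ⊗ h) = c · h`. -/
structure IsPartialModuleCoalgebra (act : C ⊗[k] K →ₗ[k] C) : Prop where
  /-- `c · 1 = c` -/
  act_one : ∀ c : C, act (c ⊗ₜ 1) = c
  /-- `Δ(c · h) = c₁ · h₁ ⊗ c₂ · h₂` -/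
  comul_act : ∀ (c : C) (h : K), comul (R := k) (act (c ⊗ₜ h)) =
    TensorProduct.map act act
      (TensorProduct.tensorTensorTensorComm k C C K K (comul c ⊗ₜ comul h))
  /-- `(c · h) · g = ε(c₁ · h₁) (c₂ · h₂ g)` -/
  act_act : ∀ (c : C) (h g : K), act (act (c ⊗ₜ h) ⊗ₜ g) =
    TensorProduct.lid k C (TensorProduct.map (counit ∘ₗ act)
      (act ∘ₗ (LinearMap.mulRight k g).lTensor C)
      (TensorProduct.tensorTensorTensorComm k C C K K (comul c ⊗ₜ comul h)))

/-- `π`, viewed as an endomorphism of `D`, is a comultiplicative projection from `D` onto `θ(C)`;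
it is not required to preserve the counit. -/
structure IsComultiplicativeProjection (θ : C →ₗc[k] D) (π : D →ₗ[k] D) : Prop where
  range_eq : LinearMap.range π = LinearMap.range (θ : C →ₗ[k] D)
  idem : ∀ d : D, π (π d) = π d
  comul_proj : ∀ d : D, comul (R := k) (π d) = TensorProduct.map π π (comul d)

/-- `((D, actD), θ, π)` is a globalization of the right partial `K`-module coalgebra `(C, actC)`. -/
structure IsModuleGlobalization (actC : C ⊗[k] K →ₗ[k] C) (actD : D ⊗[k] K →ₗ[k] D)
    (θ : C →ₗc[k] D) (π : D →ₗ[k] D) : Prop where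
  isModuleCoalgebra : IsModuleCoalgebra actD
  injective : Function.Injective θ
  isProjection : IsComultiplicativeProjection θ π
  /-- `π(π(d) · h) = π(ε(π(d₁)) d₂ · h)` -/
  proj_act : ∀ (d : D) (h : K), π (actD (π d ⊗ₜ h)) =
    π (actD (TensorProduct.lid k D (TensorProduct.map (counit ∘ₗ π) LinearMap.id (comul d)) ⊗ₜ h))
  /-- `θ(c · h) = π(θ(c) · h)` -/
  map_act : ∀ (c : C) (h : K), θ (actC (c ⊗ₜ h)) = π (actD (θ c ⊗ₜ h))
  /-- `D = θ(C) · K`: the elements `θ(c) · h` span `D`. -/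
  generated : Submodule.span k {d : D | ∃ (c : C) (h : K), d = actD (θ c ⊗ₜ h)} = ⊤

end Module

/-! ### (Partial) comodule coalgebras and their globalizations -/

section Comodule

variable {k H C D : Type*} [Field k] [Ring H] [HopfAlgebra k H]
  [AddCommGroup C] [Module k C] [Coalgebra k C] [AddCommGroup D] [Module k D] [Coalgebra k D]

/-- `D` is a left `H`-comodule coalgebra via `lam`. -/
structure IsComoduleCoalgebra (lam : D →ₗ[k] H ⊗[k] D) : Prop where
  /-- `(ε ⊗ I) λ(d) = d` -/
  counit_coact : ∀ d : D, TensorProduct.lid k D ((counit (R := k) (A := H)).rTensor D (lam d)) = d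
  /-- `(I ⊗ Δ) λ(d) = (m ⊗ I ⊗ I) (I ⊗ τ ⊗ I) (λ ⊗ λ) Δ(d)` -/
  comul_coact : ∀ d : D, (comul (R := k) (A := D)).lTensor H (lam d) =
    (LinearMap.mul' k H).rTensor (D ⊗[k] D)
      (TensorProduct.tensorTensorTensorComm k H D H D (TensorProduct.map lam lam (comul d)))
  /-- `(I ⊗ λ) λ(d) = (Δ ⊗ I) λ(d)` -/
  coact_coact : ∀ d : D, lam.lTensor H (lam d) =
    TensorProduct.assoc k H H D ((comul (R := k) (A := H)).rTensor D (lam d))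

/-- The map `∇ = (I ⊗ ε) λ' : C → H`. -/
def nabla (lam : C →ₗ[k] H ⊗[k] C) : C →ₗ[k] H :=
  (TensorProduct.rid k H).toLinearMap ∘ₗ (counit (R := k) (A := C)).lTensor H ∘ₗ lam

/-- `C` is a left partial `H`-comodule coalgebra via `lam`. -/
structure IsPartialComoduleCoalgebra (lam : C →ₗ[k] H ⊗[k] C) : Prop where
  /-- `(ε ⊗ I) λ'(c) = c` -/
  counit_coact : ∀ c : C, TensorProduct.lid k C ((counit (R := k) (A := H)).rTensor C (lam c)) = c
  /-- `(I ⊗ Δ) λ'(c) = (m ⊗ I ⊗ I) (I ⊗ τ ⊗ I) (λ' ⊗ λ') Δ(c)` -/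
  comul_coact : ∀ c : C, (comul (R := k) (A := C)).lTensor H (lam c) =
    (LinearMap.mul' k H).rTensor (C ⊗[k] C)
      (TensorProduct.tensorTensorTensorComm k H C H C (TensorProduct.map lam lam (comul c)))
  /-- `(I ⊗ λ') λ'(c) = (m ⊗ I ⊗ I) (∇ ⊗ (Δ ⊗ I) λ') Δ(c)` -/
  coact_coact : ∀ c : C, lam.lTensor H (lam c) =
    (LinearMap.mul' k H).rTensor (H ⊗[k] C)
      ((TensorProduct.assoc k H H (H ⊗[k] C)).symm
        (TensorProduct.map (nabla lam)
          ((TensorProduct.assoc k H H C).toLinearMap ∘ₗ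
            (comul (R := k) (A := H)).rTensor C ∘ₗ lam) (comul c)))

/-- `M` is a subcomodule coalgebra of `(D, lam)`: `Δ(M) ⊆ M ⊗ M` and `λ(M) ⊆ H ⊗ M`. -/
structure IsSubcomoduleCoalgebra (lam : D →ₗ[k] H ⊗[k] D) (M : Submodule k D) : Prop where
  comul_mem : ∀ m ∈ M, comul (R := k) m ∈ LinearMap.range (TensorProduct.map M.subtype M.subtype)
  coact_mem : ∀ m ∈ M, lam m ∈ LinearMap.range (M.subtype.lTensor H)

/-- `((D, lamD), θ, π)` is a globalization of the left partial `H`-comodule coalgebra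
`(C, lamC)`. -/
structure IsComoduleGlobalization (lamC : C →ₗ[k] H ⊗[k] C) (lamD : D →ₗ[k] H ⊗[k] D)
    (θ : C →ₗc[k] D) (π : D →ₗ[k] D) : Prop where
  isComoduleCoalgebra : IsComoduleCoalgebra lamD
  injective : Function.Injective θ
  isProjection : IsComultiplicativeProjection θ π
  /-- `π(d)⁻¹ ⊗ π(π(d)⁰) = d₂⁻¹ ⊗ ε(π(d₁)) π(d₂⁰)` -/
  proj_coact : ∀ d : D, π.lTensor H (lamD (π d)) =
    TensorProduct.lid k (H ⊗[k] D)
      (TensorProduct.map (counit ∘ₗ π) (π.lTensor H ∘ₗ lamD) (comul d))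
  /-- `θ(c)⁻¹ ⊗ π(θ(c)⁰) = c⁻¹ ⊗ θ(c⁰)` -/
  map_coact : ∀ c : C, π.lTensor H (lamD (θ c)) = (θ : C →ₗ[k] D).lTensor H (lamC c)
  /-- No proper subcomodule coalgebra of `D` contains `θ(C)`. -/
  generated : ∀ M : Submodule k D, IsSubcomoduleCoalgebra lamD M → (∀ c : C, θ c ∈ M) → M = ⊤

/-- The map `C ⊗ H⁰ → C`, `c ⊗ f ↦ c · f = f(c⁻¹) c⁰`, induced by `lam : C → H ⊗ C`. -/
def inducedAction (lam : C →ₗ[k] H ⊗[k] C) : C ⊗[k] FiniteDual k H →ₗ[k] C :=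
  TensorProduct.lift (LinearMap.mk₂ k
    (fun c f => TensorProduct.lid k C (f.toDual.rTensor C (lam c)))
    (fun c c' f => by simp only [map_add])
    (fun r c f => by simp only [map_smul])
    (fun c f g => by
      change TensorProduct.lid k C ((f.toDual + g.toDual).rTensor C (lam c)) = _
      rw [LinearMap.rTensor_add, LinearMap.add_apply, map_add])
    (fun r c f => by
      change TensorProduct.lid k C ((r • f.toDual).rTensor C (lam c)) = _
      rw [LinearMap.rTensor_smul, LinearMap.smul_apply, map_smul]))

end Comodule

end

end PartialHopf

/-! Applying `f ⊗ I` to an identity between elements of `H ⊗ V` turns comodule statements into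
module statements. Under this slicing the product of `H` becomes the comultiplication of `H⁰`, since
`f(ab) = f₁(a) f₂(b)`, the comultiplication of `H` becomes the product of `H⁰`, and `ε_H` is the
unit of `H⁰`. Each axiom of the partial action, of the action on `D`, and of compatibility with `θ`
and `π` is thus a slice of its comodule counterpart; `slice_mul'`, `slice_slice_comul` and
`slice_mul_left` are the translation rules.

Generation is a minimality condition on one side and a spanning condition on the other, so it needs
its own argument. The span `M` of `θ(C) · H⁰` is a subcoalgebra stable under `H⁰`. Since `H⁰`
separates points, stability means `λ(M) ⊆ H ⊗ M` (`SeparatesPoints.mem_range_lTensor`). As `M`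
contains `θ(C)`, minimality of `D` gives `M = D`. -/

namespace PartialHopf

noncomputable section

namespace FiniteDual

variable {k H V W : Type*} [Field k] [Ring H] [AddCommGroup V] [Module k V]
  [AddCommGroup W] [Module k W]

/-! ### Slicing tensors in `H ⊗ V` by elements of `H⁰`. -/

section Slice

variable [Bialgebra k H]

variable (V) in
/-- The map `H ⊗ V → V`, `h ⊗ v ↦ f(h) v`, linear in `f`. -/
def slice : FiniteDual k H →ₗ[k] H ⊗[k] V →ₗ[k] V where
  toFun f := (TensorProduct.lid k V).toLinearMap ∘ₗ f.toDual.rTensor V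
  map_add' f g := by
    change (TensorProduct.lid k V).toLinearMap ∘ₗ (f.toDual + g.toDual).rTensor V = _
    rw [LinearMap.rTensor_add, LinearMap.comp_add]
  map_smul' r f := by
    change (TensorProduct.lid k V).toLinearMap ∘ₗ (r • f.toDual).rTensor V = _
    rw [LinearMap.rTensor_smul, LinearMap.comp_smul]
    rfl

@[simp] theorem slice_tmul (f : FiniteDual k H) (h : H) (v : V) :
    slice V f (h ⊗ₜ v) = ev h f • v := by
  simp [slice, ev_apply]

/-- Slicing touches only the `H` factor, so it commutes with any linear map on the other one. This
is how `π`, `θ`, `Δ` and `λ` pass through the action. -/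
theorem slice_lTensor (f : FiniteDual k H) (g : V →ₗ[k] W) (t : H ⊗[k] V) :
    slice W f (g.lTensor H t) = g (slice V f t) := by
  induction t with
  | zero => simp
  | tmul h v => simp
  | add x y hx hy => simp only [map_add, hx, hy]

theorem slice_one (t : H ⊗[k] V) :
    slice V 1 t = TensorProduct.lid k V ((counit (R := k) (A := H)).rTensor V t) := rfl

/-- For `g = ε_C` and `t = λ'(c)` this reads `f(∇(c)) = ε(c · f)`, the source of the scalar factor
in the partial action axiom. -/
theorem ev_rid_lTensor (f : FiniteDual k H) (g : V →ₗ[k] k) (t : H ⊗[k] V) :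
    ev (TensorProduct.rid k H (g.lTensor H t)) f = g (slice V f t) := by
  simp only [ev_apply]
  induction t with
  | zero => simp
  | tmul h v => simp [ev_apply, mul_comm]
  | add x y hx hy => simp only [map_add, hx, hy]

theorem pairEv_toDual (f : FiniteDual k H) (q : V →ₗ[k] k) (t : H ⊗[k] V) :
    pairEv f.toDual q t = q (slice V f t) := by
  induction t with
  | zero => simp
  | tmul h v => simp [ev_apply]
  | add x y hx hy => simp only [map_add, hx, hy]

/-- `f(ab) v ⊗ w = f₁(a) v ⊗ f₂(b) w`. -/
theorem slice_mul' (f : FiniteDual k H) (s : H ⊗[k] V) (t : H ⊗[k] W) :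
    slice (V ⊗[k] W) f ((LinearMap.mul' k H).rTensor (V ⊗[k] W)
      (TensorProduct.tensorTensorTensorComm k H V H W (s ⊗ₜ t))) =
    TensorProduct.map ((slice V).flip s) ((slice W).flip t) (comul f) := by
  induction s with
  | zero => simp
  | add x y hx hy =>
    simp only [TensorProduct.add_tmul, map_add, hx, hy, TensorProduct.map_add_left,
      LinearMap.add_apply]
  | tmul a v =>
    induction t with
    | zero => simp
    | add x y hx hy =>
      simp only [TensorProduct.tmul_add, map_add, hx, hy, TensorProduct.map_add_right,
        LinearMap.add_apply]
    | tmul b w =>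
      simp only [TensorProduct.tensorTensorTensorComm_tmul, LinearMap.rTensor_tmul,
        LinearMap.mul'_apply, slice_tmul]
      -- Once `f(ab)` is written through `Δ(f)`, both sides are linear in `Δ(f)`, so an arbitrary
      -- tensor `u` can replace it.
      rw [← pairEv_comul]
      generalize comul (R := k) f = u
      induction u with
      | zero => simp
      | tmul x y =>
        simp only [pairEv_tmul, TensorProduct.map_tmul, LinearMap.flip_apply, slice_tmul,
          TensorProduct.smul_tmul_smul]
      | add x y hx hy => simp only [map_add, add_smul, hx, hy]

/-- `f(h₁) g(h₂) v = (f * g)(h) v`. -/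
theorem slice_slice_comul (f g : FiniteDual k H) (t : H ⊗[k] V) :
    slice V g (slice (H ⊗[k] V) f
      (TensorProduct.assoc k H H V ((comul (R := k) (A := H)).rTensor V t))) =
    slice V (f * g) t := by
  induction t with
  | zero => simp
  | add x y hx hy => simp only [map_add, hx, hy]
  | tmul a v =>
    rw [slice_tmul, ev_mul_repr (ℛ k a), LinearMap.rTensor_tmul]
    conv_lhs => rw [← (ℛ k a).eq]
    simp [TensorProduct.sum_tmul, Finset.sum_smul, mul_smul]

/-- `f(ha) w = f₁(h) f₂(a) w`. -/
theorem slice_mul_left (f : FiniteDual k H) (h : H) (t : H ⊗[k] W) :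
    slice W f ((LinearMap.mul' k H).rTensor W ((TensorProduct.assoc k H H W).symm (h ⊗ₜ t))) =
    TensorProduct.lid k W (TensorProduct.map (ev h) ((slice W).flip t) (comul f)) := by
  induction t with
  | zero => simp
  | add x y hx hy =>
    simp only [TensorProduct.tmul_add, map_add, hx, hy, TensorProduct.map_add_right,
      LinearMap.add_apply]
  | tmul a w =>
    simp only [TensorProduct.assoc_symm_tmul, LinearMap.rTensor_tmul, LinearMap.mul'_apply,
      slice_tmul]
    rw [← pairEv_comul]
    generalize comul (R := k) f = u
    induction u with
    | zero => simp
    | tmul x y =>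
      simp only [pairEv_tmul, TensorProduct.map_tmul, LinearMap.flip_apply, slice_tmul,
        TensorProduct.lid_tmul, mul_smul]
    | add x y hx hy => simp only [map_add, add_smul, hx, hy]

/-- If `H⁰` separates points, a tensor in `H ⊗ V` all of whose slices lie in `M` is in `H ⊗ M`. -/
theorem SeparatesPoints.mem_range_lTensor (hsep : SeparatesPoints k H) (M : Submodule k V)
    {t : H ⊗[k] V} (ht : ∀ f : FiniteDual k H, slice V f t ∈ M) :
    t ∈ LinearMap.range (M.subtype.lTensor H) := by
  -- By right exactness of `H ⊗ -`, membership in `H ⊗ M` means vanishing in `H ⊗ (V ⧸ M)`.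
  have hexact : Function.Exact (M.subtype.lTensor H) (M.mkQ.lTensor H) :=
    lTensor_exact H (LinearMap.exact_subtype_mkQ M) M.mkQ_surjective
  refine (hexact t).mp ?_
  -- Vanishing is tested by pairs `f ⊗ q`: `H⁰` separates `H` by hypothesis, and the full dual
  -- separates `V ⧸ M`. The value is `q` of the class of a slice, and the slice lies in `M`.
  refine tensor_eq_of_separating (fun f : FiniteDual k H => f.toDual)
    (fun q : Module.Dual k (V ⧸ M) => q) hsep
    (fun w hw => (Module.forall_dual_apply_eq_zero_iff k w).mp hw) fun f q => ?_
  rw [pairEv_toDual, slice_lTensor, (Submodule.Quotient.mk_eq_zero M).mpr (ht f) |>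
    (show M.mkQ _ = 0 from ·), map_zero, map_zero]

end Slice

end FiniteDual

open FiniteDual

/-! ### The induced action expressed through slices. -/

section Action

variable {k H C : Type*} [Field k] [Ring H] [HopfAlgebra k H] [AddCommGroup C] [Module k C]

theorem inducedAction_tmul (lam : C →ₗ[k] H ⊗[k] C) (c : C) (f : FiniteDual k H) :
    inducedAction lam (c ⊗ₜ f) = slice C f (lam c) := rfl

/-- `f(c₁⁻¹ c₂⁻¹) c₁⁰ ⊗ c₂⁰ = c₁ · f₁ ⊗ c₂ · f₂`. -/
theorem map_inducedAction (lam : C →ₗ[k] H ⊗[k] C) (f : FiniteDual k H) (x : C ⊗[k] C) :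
    TensorProduct.map (inducedAction lam) (inducedAction lam)
      (TensorProduct.tensorTensorTensorComm k C C _ _ (x ⊗ₜ comul f)) =
    slice (C ⊗[k] C) f ((LinearMap.mul' k H).rTensor (C ⊗[k] C)
      (TensorProduct.tensorTensorTensorComm k H C H C (TensorProduct.map lam lam x))) := by
  induction x with
  | zero => simp
  | add x y hx hy => simp only [TensorProduct.add_tmul, map_add, hx, hy]
  | tmul c d =>
    rw [TensorProduct.map_tmul, slice_mul']
    generalize comul (R := k) f = u
    induction u with
    | zero => simp
    | tmul x y => simp [inducedAction_tmul]
    | add x y hx hy => simp only [TensorProduct.tmul_add, map_add, hx, hy]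

/-- Isolates `(I ⊗ λ)λ(c)`, the left side of both the partial and the global coassociativity axioms.
The first action slices the outer leg of `H`. -/
theorem inducedAction_inducedAction (lam : C →ₗ[k] H ⊗[k] C) (c : C) (f g : FiniteDual k H) :
    inducedAction lam (inducedAction lam (c ⊗ₜ f) ⊗ₜ g) =
      slice C g (slice (H ⊗[k] C) f (lam.lTensor H (lam c))) := by
  rw [inducedAction_tmul, inducedAction_tmul, slice_lTensor]

end Action

/-! ### Transfer of the axioms, and generation. -/

section Globalization

variable {k H C D : Type*} [Field k] [Ring H] [HopfAlgebra k H]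
  [AddCommGroup C] [Module k C] [Coalgebra k C] [AddCommGroup D] [Module k D] [Coalgebra k D]

/-- The hypothesis is the single identity shared by partial and global comodule coalgebras, so the
lemma serves both. -/
theorem comul_inducedAction {lam : C →ₗ[k] H ⊗[k] C}
    (hlam : ∀ c : C, (comul (R := k) (A := C)).lTensor H (lam c) =
      (LinearMap.mul' k H).rTensor (C ⊗[k] C)
        (TensorProduct.tensorTensorTensorComm k H C H C (TensorProduct.map lam lam (comul c))))
    (c : C) (f : FiniteDual k H) :
    comul (R := k) (inducedAction lam (c ⊗ₜ f)) =
      TensorProduct.map (inducedAction lam) (inducedAction lam)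
        (TensorProduct.tensorTensorTensorComm k C C _ _ (comul c ⊗ₜ comul f)) := by
  rw [inducedAction_tmul, ← slice_lTensor, hlam, map_inducedAction]

theorem IsPartialComoduleCoalgebra.isPartialModuleCoalgebra {lam : C →ₗ[k] H ⊗[k] C}
    (hC : IsPartialComoduleCoalgebra lam) : IsPartialModuleCoalgebra (inducedAction lam) where
  act_one c := by rw [inducedAction_tmul, slice_one, hC.counit_coact]
  comul_act := comul_inducedAction hC.comul_coact
  act_act c f g := by
    rw [inducedAction_inducedAction, hC.coact_coact]
    generalize comul (R := k) c = x
    induction x with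
    | zero => simp
    | add x y hx hy => simp only [TensorProduct.add_tmul, map_add, hx, hy]
    | tmul c d =>
      rw [TensorProduct.map_tmul, slice_mul_left]
      generalize comul (R := k) f = u
      induction u with
      | zero => simp
      | add x y hx hy => simp only [TensorProduct.tmul_add, map_add, hx, hy]
      -- The `∇` leg gives `f₁(∇(c)) = ε(c · f₁)`, and slicing `(Δ ⊗ I)λ(d)` by `f₂` and then `g`
      -- gives `d · (f₂ * g)`.
      | tmul f₁ f₂ =>
        simp [inducedAction_tmul, slice_slice_comul, nabla, ev_rid_lTensor]

theorem IsComoduleCoalgebra.isModuleCoalgebra {lam : D →ₗ[k] H ⊗[k] D}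
    (hD : IsComoduleCoalgebra lam) : IsModuleCoalgebra (inducedAction lam) where
  act_one d := by rw [inducedAction_tmul, slice_one, hD.counit_coact]
  comul_act := comul_inducedAction hD.comul_coact
  act_act d f g := by
    rw [inducedAction_inducedAction, hD.coact_coact, slice_slice_comul, inducedAction_tmul]

/-- The span of `θ(C) · H⁰` is a subcomodule coalgebra if `H⁰` separates points. -/
theorem isSubcomoduleCoalgebra_span {lam : D →ₗ[k] H ⊗[k] D} (hD : IsComoduleCoalgebra lam)
    (hsep : SeparatesPoints k H) (θ : C →ₗc[k] D) :
    IsSubcomoduleCoalgebra lam (Submodule.span k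
      {d : D | ∃ (c : C) (f : FiniteDual k H), d = inducedAction lam (θ c ⊗ₜ f)}) := by
  set M := Submodule.span k
    {d : D | ∃ (c : C) (f : FiniteDual k H), d = inducedAction lam (θ c ⊗ₜ f)} with hM
  have hmem : ∀ c (f : FiniteDual k H), inducedAction lam (θ c ⊗ₜ f) ∈ M :=
    fun c f => Submodule.subset_span ⟨c, f, rfl⟩
  refine ⟨fun m hm => ?_, fun m hm => hsep.mem_range_lTensor M fun g => ?_⟩
  · induction hm using Submodule.span_induction with
    | zero => rw [map_zero]; exact zero_mem _
    | add x y _ _ hx hy => rw [map_add]; exact add_mem hx hy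
    | smul r x _ hx => rw [map_smul]; exact Submodule.smul_mem _ r hx
    | mem x hx =>
      obtain ⟨c, f, rfl⟩ := hx
      -- As `θ` is a coalgebra map, `Δ(θ(c) · f) = θ(c₁) · f₁ ⊗ θ(c₂) · f₂`, a sum of tensors of
      -- generators of `M`.
      rw [hD.isModuleCoalgebra.comul_act, ← CoalgHomClass.map_comp_comul_apply]
      generalize comul (R := k) c = x
      generalize comul (R := k) f = u
      induction x with
      | zero => simp
      | add x y hx hy => simp only [TensorProduct.add_tmul, map_add]; exact add_mem hx hy
      | tmul c d =>
        induction u with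
        | zero => simp
        | add x y hx hy => simp only [TensorProduct.tmul_add, map_add]; exact add_mem hx hy
        | tmul f g => exact ⟨⟨_, hmem c f⟩ ⊗ₜ ⟨_, hmem d g⟩, rfl⟩
  -- The slices of `λ(m)` are the elements `m · g`, so only stability of `M` remains; on generators
  -- it is `(θ(c) · f) · g = θ(c) · (f * g)`.
  · rw [← inducedAction_tmul]
    induction hm using Submodule.span_induction with
    | zero => simp
    | add x y _ _ hx hy => rw [TensorProduct.add_tmul, map_add]; exact add_mem hx hy
    | smul r x _ hx =>
      rw [← TensorProduct.smul_tmul', map_smul]; exact Submodule.smul_mem _ r hx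
    | mem x hx =>
      obtain ⟨c, f, rfl⟩ := hx
      rw [hD.isModuleCoalgebra.act_act]
      exact hmem c _

theorem IsComoduleGlobalization.isModuleGlobalization {lamC : C →ₗ[k] H ⊗[k] C}
    {lamD : D →ₗ[k] H ⊗[k] D} {θ : C →ₗc[k] D} {π : D →ₗ[k] D}
    (h : IsComoduleGlobalization lamC lamD θ π) (hsep : SeparatesPoints k H) :
    IsModuleGlobalization (inducedAction lamC) (inducedAction lamD) θ π where
  isModuleCoalgebra := h.isComoduleCoalgebra.isModuleCoalgebra
  injective := h.injective
  isProjection := h.isProjection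
  proj_act d f := by
    rw [inducedAction_tmul, inducedAction_tmul, ← slice_lTensor, h.proj_coact]
    generalize comul (R := k) d = x
    induction x with
    | zero => simp
    | add x y hx hy => simp only [map_add, hx, hy]
    -- On `x ⊗ y` both sides equal `ε(π(x)) π(y · f)`.
    | tmul x y => simp [slice_lTensor]
  map_act c f := by
    rw [inducedAction_tmul, inducedAction_tmul, ← slice_lTensor, h.map_coact, slice_lTensor]
    rfl
  -- Minimality of `D` applies because `θ(c) = θ(c) · 1` lies in the span.
  generated := h.generated _ (isSubcomoduleCoalgebra_span h.isComoduleCoalgebra hsep θ) fun c =>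
    Submodule.subset_span ⟨c, 1, (h.isComoduleCoalgebra.isModuleCoalgebra.act_one _).symm⟩

end Globalization

end

end PartialHopf

theorem mainTheorem4 {k H C D : Type*} [Field k] [Ring H] [HopfAlgebra k H]
    [AddCommGroup C] [Module k C] [Coalgebra k C]
    [AddCommGroup D] [Module k D] [Coalgebra k D]
    (lamC : C →ₗ[k] H ⊗[k] C) (lamD : D →ₗ[k] H ⊗[k] D)
    (θ : C →ₗc[k] D) (π : D →ₗ[k] D)
    (hC : PartialHopf.IsPartialComoduleCoalgebra lamC)
    (hglob : PartialHopf.IsComoduleGlobalization lamC lamD θ π)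
    (hsep : PartialHopf.FiniteDual.SeparatesPoints k H) :
    PartialHopf.IsPartialModuleCoalgebra (PartialHopf.inducedAction lamC) ∧
      PartialHopf.IsModuleGlobalization
        (PartialHopf.inducedAction lamC) (PartialHopf.inducedAction lamD) θ π := by
  exact ⟨hC.isPartialModuleCoalgebra, hglob.isModuleGlobalization hsep⟩
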